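/- Let $0<H<1$, $\varepsilon>0$, $T>0$, and let $\gamma=\mathcal N(0,1)$. Let $G\in L^p(\mathbb R,\gamma)$ for some $p>2$, with $\gamma(\{x: G(x)=0\})=0$. Let $m$ be the Hermite rank of $G$, i.e. the smallest $n\ge 0$ with $c_n\neq 0$ in the expansion $G=\sum_n c_nH_n$ in the Hermite polynomials $H_n(x)=(-1)^ne^{x^2/2}\frac{d^n}{dx^n}e^{-x^2/2}$. Put $H^*(m)=(H-1)m+1$ and $$\alpha=\begin{cases}\varepsilon^{H^*(m)-1}, & H^*(m)>1/2,\\[2pt] \dfrac{1}{\sqrt{\varepsilon}\,|\log\varepsilon|}, & H^*(m)=1/2,\\[2pt] \dfrac1{\sqrt\varepsilon}, & H^*(m)<1/2,\end{cases}$$ and assume $\varepsilon\ne 1$ if $H^*(m)=1/2$, so that $\alpha$ is defined. Let $(B_t)_{t\in\mathbb R}$ be a fractional Brownian motion with Hurst parameter $H$, that is, a centred continuous Gaussian process with $\mathbb E[B_tB_s]=\frac12(|t|^{2H}+|s|^{2H}-|t-s|^{2H})$. Let $(Y_t)_{t\in\mathbb R}$ be the stationary solution of $$dY_t=-\frac1\varepsilon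 Y_t\,dt+\frac{\sigma}{\varepsilon^H}\,dB_t,\qquad \sigma=\sqrt{\frac{2}{\Gamma(2H+1)}},$$ and let $(X_t)_{t\ge 0}$ satisfy $dX_t=\alpha\,G(Y_t)\,dt$, with any initial value $X_0$. For $N\ge1$ and $\delta=T/N$ let $$\hat H_{\varepsilon,\delta}=\frac12-\frac1{2\log 2}\log\left(\frac{\sum_{i=0}^{2N-1}\bigl(X_{(i+1)\delta/2}-X_{i\delta/2}\bigr)^2}{\sum_{i=0}^{N-1}\bigl(X_{(i+1)\delta}-X_{i\delta}\bigr)^2}\right).$$ Then, with $\varepsilon$ and $T=N\delta$ fixed, $$\hat H_{\varepsilon,\delta}\longrightarrow 1\quad\text{in probability as }\delta\to0\ (\text{equivalently, as } N\to\infty),$$ whatever the value of $H^*(m)$. -/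

import Mathlib

namespace SlowFast

open MeasureTheory ProbabilityTheory

/-- The self-similarity index `H*(m) = (H - 1) m + 1`. -/
noncomputable def hStar (H : ℝ) (m : ℕ) : ℝ := (H - 1) * m + 1

/-- The scaling factor `α(ε, h)` of the slow equation. For `h = 1/2` and `ε = 1` the formula is
a division by zero and has no meaning. -/
noncomputable def scaling (ε h : ℝ) : ℝ :=
  if 1 / 2 < h then ε ^ (h - 1)
  else if h = 1 / 2 then 1 / (√ε * |Real.log ε|)
  else 1 / √ε

/-- The coefficient `c_n = (1 / n!) ∫ G H_n dγ` of `G` in the expansion `G = ∑ c_n H_n`, where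
`H_n` is the `n`-th (probabilists') Hermite polynomial and `γ = N(0, 1)`. -/
noncomputable def hermiteCoeff (G : ℝ → ℝ) (n : ℕ) : ℝ :=
  (∫ x, G x * Polynomial.aeval x (Polynomial.hermite n) ∂(gaussianReal 0 1)) / n.factorial

/-- `m` is the Hermite rank of `G`: the smallest `n` with `c_n ≠ 0`. -/
def IsHermiteRank (G : ℝ → ℝ) (m : ℕ) : Prop :=
  IsLeast {n : ℕ | hermiteCoeff G n ≠ 0} m

/-- `B` is a (two-sided) fractional Brownian motion with Hurst parameter `H` under `P`: a centred
Gaussian process, almost surely continuous, with the usual covariance. -/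
structure IsFractionalBrownianMotion {Ω : Type*} [MeasurableSpace Ω] (H : ℝ) (B : ℝ → Ω → ℝ)
    (P : Measure Ω) : Prop where
  isGaussianProcess : IsGaussianProcess B P
  integral_eq_zero : ∀ t, ∫ ω, B t ω ∂P = 0
  covariance_eq : ∀ s t, ∫ ω, B s ω * B t ω ∂P =
    (|t| ^ (2 * H) + |s| ^ (2 * H) - |t - s| ^ (2 * H)) / 2
  continuous_paths : ∀ᵐ ω ∂P, Continuous fun t => B t ω

/-- A process indexed by `ℝ` is (strictly) stationary: its finite-dimensional laws are invariant
under time shifts. -/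
def IsStationary {Ω : Type*} [MeasurableSpace Ω] (Y : ℝ → Ω → ℝ) (P : Measure Ω) : Prop :=
  ∀ (h : ℝ) (I : Finset ℝ),
    IdentDistrib (fun ω (i : I) => Y i ω) (fun ω (i : I) => Y (i + h) ω) P P

/-- The constant `σ > 0` with `σ² = 2 / Γ(2H + 1)`. -/
noncomputable def sigma (H : ℝ) : ℝ := √(2 / Real.Gamma (2 * H + 1))

/-- `Y` is the stationary solution of `dY = -(1/ε) Y dt + (σ / ε ^ H) dB`, the time-rescaled
fractional Ornstein-Uhlenbeck process. The noise is additive, so the equation is read pathwise,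
in integrated form. -/
structure IsStationaryFOU {Ω : Type*} [MeasurableSpace Ω] (H ε : ℝ) (B Y : ℝ → Ω → ℝ)
    (P : Measure Ω) : Prop where
  isStationary : IsStationary Y P
  continuous_paths : ∀ᵐ ω ∂P, Continuous fun t => Y t ω
  equation : ∀ᵐ ω ∂P, ∀ s t, Y t ω - Y s ω =
    -(1 / ε) * (∫ u in s..t, Y u ω) + sigma H / ε ^ H * (B t ω - B s ω)

/-- `X` solves `dX = a G(Y) dt` on `[0, ∞)`, almost surely, with an arbitrary initial value. -/
def IsSlowSolution {Ω : Type*} [MeasurableSpace Ω] (a : ℝ) (G : ℝ → ℝ) (X Y : ℝ → Ω → ℝ)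
    (P : Measure Ω) : Prop :=
  ∀ᵐ ω ∂P, ∀ t, 0 ≤ t →
    IntervalIntegrable (fun s => G (Y s ω)) volume 0 t ∧
      X t ω = X 0 ω + a * ∫ s in (0 : ℝ)..t, G (Y s ω)

/-- The sum of the squares of the first `N` increments of `x`, sampled with step `δ`. -/
noncomputable def quadVar (x : ℝ → ℝ) (N : ℕ) (δ : ℝ) : ℝ :=
  ∑ i ∈ Finset.range N, (x ((i + 1) * δ) - x (i * δ)) ^ 2

/-- The ratio estimator of the Hurst parameter, from the steps `δ / 2` and `δ`. -/
noncomputable def hurstRatio (x : ℝ → ℝ) (N : ℕ) (δ : ℝ) : ℝ :=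
  1 / 2 - 1 / (2 * Real.log 2) * Real.log (quadVar x (2 * N) (δ / 2) / quadVar x N δ)

end SlowFast

/-! For fixed `ε` the path of `X` is absolutely continuous with velocity `α G(Y)`, so its squared
increments see an energy, not a roughness. With step `δ` their sum is `α² δ` times the cell energy
of `G(Y)`, and for a velocity in L² these energies tend to `∫ G(Y)²` (`tendsto_cellEnergy`). The
factor `α² ≠ 0` cancels from the ratio, which tends to `1/2` as soon as the limit energy is
positive; the estimator then tends to `1/2 + 1/2 = 1`.

It remains that almost surely `G(Y)` is square integrable and nonzero a.e. on `[0, T]`. By Fubini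
both follow from `Y t` having law `γ` at each time (`IsStationaryFOU.hasLaw`). To find this law,
solve the equation from time `-r` and let `r → ∞`: the boundary terms vanish in probability, by
stationarity for `Y` and by self-similarity for `B`. Hence `Y 0` is a multiple of `∫ e^{-λu} B(-u)
du` over `u > 0`, with `λ = 1/ε`. This is Gaussian as a limit of Riemann sums, and the fBm
covariance with the choice of `σ` gives variance one. -/

namespace SlowFast

open MeasureTheory ProbabilityTheory Filter Topology Set
open scoped NNReal ENNReal

/-! ### Convergence of cell energies for L² functions -/

/-- Tagged Riemann sums over the uniform partitions of `[0, T]` converge to the integral. -/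
theorem tendsto_riemannSum {h : ℝ → ℝ} (hh : Continuous h) {T : ℝ} (hT : 0 < T) (ξ : ℕ → ℕ → ℝ)
    (hξ : ∀ N i : ℕ, i < N → ξ N i ∈ Icc (i * (T / N)) ((i + 1) * (T / N))) :
    Tendsto (fun N : ℕ => ∑ i ∈ Finset.range N, T / N * h (ξ N i)) atTop
      (𝓝 (∫ u in (0 : ℝ)..T, h u)) := by
  have hunif := isCompact_Icc (a := (0 : ℝ)) (b := T)|>.uniformContinuousOn_of_continuous
    hh.continuousOn
  rw [Metric.uniformContinuousOn_iff] at hunif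
  rw [Metric.tendsto_atTop]
  intro η hη
  obtain ⟨d, hd, hd'⟩ := hunif (η / (2 * T)) (by positivity)
  obtain ⟨M, hM⟩ := exists_nat_gt (T / d)
  refine ⟨M + 1, fun N hN => ?_⟩
  have hNM : (M : ℝ) + 1 ≤ N := by exact_mod_cast hN
  have hN0 : (0 : ℝ) < N := by linarith [M.cast_nonneg (α := ℝ)]
  set δ := T / N with hδ
  have hδ0 : 0 < δ := by positivity
  have hδd : δ < d := by
    rw [hδ, div_lt_iff₀ hN0]
    rw [div_lt_iff₀ hd] at hM
    nlinarith
  have hsplit : ∫ u in (0 : ℝ)..T, h u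
      = ∑ i ∈ Finset.range N, ∫ u in (i * δ)..((i + 1) * δ), h u := by
    have := intervalIntegral.sum_integral_adjacent_intervals (f := h) (μ := volume)
      (a := fun i : ℕ => (i : ℝ) * δ) (n := N) (fun k _ => hh.intervalIntegrable _ _)
    simp only [Nat.cast_add, Nat.cast_one, Nat.cast_zero, zero_mul] at this
    rw [this]
    congr 1
    rw [hδ]; field_simp
  rw [dist_eq_norm, hsplit, ← Finset.sum_sub_distrib]
  have hterm : ∀ i ∈ Finset.range N,
      ‖δ * h (ξ N i) - ∫ u in (i * δ)..((i + 1) * δ), h u‖ ≤ η / (2 * T) * δ := by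
    intro i hi
    rw [Finset.mem_range] at hi
    have hi1 : (i : ℝ) + 1 ≤ N := by exact_mod_cast hi
    have hTN : (i + 1) * δ ≤ T := by
      have : N * δ = T := by rw [hδ]; field_simp
      nlinarith
    have hi0 : 0 ≤ (i : ℝ) * δ := by positivity
    have h1 : δ * h (ξ N i) = ∫ u in (i * δ)..((i + 1) * δ), h (ξ N i) := by
      rw [intervalIntegral.integral_const, smul_eq_mul]; ring
    rw [h1, ← intervalIntegral.integral_sub (by simp) (hh.intervalIntegrable _ _)]
    have := intervalIntegral.norm_integral_le_of_norm_le_const (a := (i : ℝ) * δ)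
      (b := (i + 1) * δ) (f := fun u => h (ξ N i) - h u) (C := η / (2 * T)) ?_
    · refine this.trans (le_of_eq ?_)
      rw [show ((i : ℝ) + 1) * δ - i * δ = δ by ring, abs_of_pos hδ0]
    · intro u hu
      rw [uIoc_of_le (by nlinarith)] at hu
      have hx := hξ N i hi
      have := hd' (ξ N i) ⟨hi0.trans hx.1, hx.2.trans hTN⟩ u
        ⟨hi0.trans hu.1.le, hu.2.trans hTN⟩ ?_
      · rw [← dist_eq_norm]; exact this.le
      · rw [Real.dist_eq, abs_lt]
        constructor <;> nlinarith [hx.1, hx.2, hu.1, hu.2]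
  calc _ ≤ ∑ i ∈ Finset.range N, η / (2 * T) * δ := norm_sum_le_of_le _ hterm
    _ = η / 2 := by
      rw [Finset.sum_const, Finset.card_range, nsmul_eq_mul, hδ]; field_simp
    _ < η := by linarith

/-- The sum of the squared integrals over the cells of the uniform partition of `[0, T]` into `N`
cells, divided by the mesh. -/
noncomputable def cellEnergy (f : ℝ → ℝ) (T : ℝ) (N : ℕ) : ℝ :=
  ∑ i ∈ Finset.range N, (∫ u in (i * (T / N))..((i + 1) * (T / N)), f u) ^ 2 / (T / N)

/-- Cauchy–Schwarz, from expanding `∫ (f - c)² ≥ 0` with `c` the mean of `f`. -/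
theorem sq_integral_div_le {f : ℝ → ℝ} {a b : ℝ} (hab : a < b)
    (hf : IntervalIntegrable f volume a b) (hf2 : IntervalIntegrable (fun u => f u ^ 2) volume a b) :
    (∫ u in a..b, f u) ^ 2 / (b - a) ≤ ∫ u in a..b, f u ^ 2 := by
  have hba : 0 < b - a := sub_pos.2 hab
  set c := (∫ u in a..b, f u) / (b - a) with hc
  have h0 : 0 ≤ ∫ u in a..b, (f u - c) ^ 2 :=
    intervalIntegral.integral_nonneg hab.le fun u _ => sq_nonneg _
  have h1 : ∫ u in a..b, (f u - c) ^ 2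
      = (∫ u in a..b, f u ^ 2) - 2 * c * (∫ u in a..b, f u) + c ^ 2 * (b - a) := by
    have : (fun u => (f u - c) ^ 2) = fun u => (f u ^ 2 - 2 * c * f u) + c ^ 2 := by
      ext u; ring
    rw [this, intervalIntegral.integral_add (hf2.sub (hf.const_mul _)) (by simp),
      intervalIntegral.integral_sub hf2 (hf.const_mul _), intervalIntegral.integral_const_mul,
      intervalIntegral.integral_const, smul_eq_mul]
    ring
  have h2 : (∫ u in a..b, f u) = c * (b - a) := by rw [hc]; field_simp
  rw [h1, h2] at h0
  rw [h2]
  have : (c * (b - a)) ^ 2 / (b - a) = c ^ 2 * (b - a) := by field_simp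
  rw [this]; linarith

theorem mem_uIcc_cell {T : ℝ} (hT : 0 < T) {N i : ℕ} (hi : i < N) :
    uIcc ((i : ℝ) * (T / N)) ((i + 1) * (T / N)) ⊆ uIcc 0 T := by
  have hN : (0 : ℝ) < N := by exact_mod_cast (Nat.zero_le i).trans_lt hi
  have hi1 : (i : ℝ) + 1 ≤ N := by exact_mod_cast hi
  have hδ0 : 0 < T / N := by positivity
  have hTN : N * (T / N) = T := by field_simp
  rw [uIcc_of_le (by nlinarith), uIcc_of_le hT.le]
  exact Icc_subset_Icc (by positivity) (by nlinarith)

theorem sum_integral_cell {f : ℝ → ℝ} {T : ℝ} (hT : 0 < T) {N : ℕ} (hN : 0 < N)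
    (hf : IntervalIntegrable f volume 0 T) :
    ∑ i ∈ Finset.range N, ∫ u in (i * (T / N))..((i + 1) * (T / N)), f u
      = ∫ u in (0 : ℝ)..T, f u := by
  have := intervalIntegral.sum_integral_adjacent_intervals (f := f) (μ := volume)
    (a := fun i : ℕ => (i : ℝ) * (T / N)) (n := N)
    (fun k hk => by simpa using hf.mono_set (mem_uIcc_cell hT hk))
  simp only [Nat.cast_add, Nat.cast_one, Nat.cast_zero, zero_mul] at this
  rw [this]
  congr 1
  have : (0 : ℝ) < N := by exact_mod_cast hN
  field_simp

/-- Cell averaging contracts L². The bound is uniform in `N`, so approximating `f` by continuous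
functions costs the same error at every scale. -/
theorem cellEnergy_le {f : ℝ → ℝ} {T : ℝ} (hT : 0 < T) {N : ℕ} (hN : 0 < N)
    (hf : IntervalIntegrable f volume 0 T)
    (hf2 : IntervalIntegrable (fun u => f u ^ 2) volume 0 T) :
    cellEnergy f T N ≤ ∫ u in (0 : ℝ)..T, f u ^ 2 := by
  rw [← sum_integral_cell hT hN hf2, cellEnergy]
  refine Finset.sum_le_sum fun i hi => ?_
  rw [Finset.mem_range] at hi
  have hN' : (0 : ℝ) < N := by exact_mod_cast hN
  have hδ0 : 0 < T / N := by positivity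
  have h := sq_integral_div_le (f := f) (a := i * (T / N)) (b := (i + 1) * (T / N)) (by nlinarith)
    (hf.mono_set (mem_uIcc_cell hT hi)) (hf2.mono_set (mem_uIcc_cell hT hi))
  rwa [show ((i : ℝ) + 1) * (T / N) - i * (T / N) = T / N by ring] at h

/-- The mean value theorem for the primitive turns each cell integral into `T / N * g ξ`, so the
energy is a tagged Riemann sum of `g²`. -/
theorem tendsto_cellEnergy_of_continuous {g : ℝ → ℝ} (hg : Continuous g) {T : ℝ} (hT : 0 < T) :
    Tendsto (cellEnergy g T) atTop (𝓝 (∫ u in (0 : ℝ)..T, g u ^ 2)) := by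
  have key : ∀ N i : ℕ, ∃ ξ : ℝ, i < N → ξ ∈ Icc ((i : ℝ) * (T / N)) ((i + 1) * (T / N)) ∧
      ∫ u in (i * (T / N))..((i + 1) * (T / N)), g u = T / N * g ξ := by
    intro N i
    by_cases hi : i < N
    · have hN : (0 : ℝ) < N := by exact_mod_cast (Nat.zero_le i).trans_lt hi
      have hδ0 : 0 < T / N := by positivity
      have hlt : (i : ℝ) * (T / N) < (i + 1) * (T / N) := by nlinarith
      obtain ⟨ξ, hξ, h⟩ := exists_deriv_eq_slope (fun t => ∫ u in (i * (T / N))..t, g u) hlt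
        (fun t _ => (intervalIntegral.integral_hasDerivAt_right (hg.intervalIntegrable _ _)
          (hg.stronglyMeasurableAtFilter _ _) hg.continuousAt).continuousAt.continuousWithinAt)
        (fun t _ => (intervalIntegral.integral_hasDerivAt_right (hg.intervalIntegrable _ _)
          (hg.stronglyMeasurableAtFilter _ _)
          hg.continuousAt).differentiableAt.differentiableWithinAt)
      rw [(intervalIntegral.integral_hasDerivAt_right (hg.intervalIntegrable _ _)
          (hg.stronglyMeasurableAtFilter _ _) hg.continuousAt).deriv] at h
      refine ⟨ξ, fun _ => ⟨Ioo_subset_Icc_self hξ, ?_⟩⟩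
      rw [h, intervalIntegral.integral_same,
        show ((i : ℝ) + 1) * (T / N) - i * (T / N) = T / N by ring]
      field_simp
      ring
    · exact ⟨0, fun h => absurd h hi⟩
  choose ξ hξ using key
  refine (tendsto_riemannSum (h := fun u => g u ^ 2) (by fun_prop) hT ξ
    fun N i hi => (hξ N i hi).1).congr fun N => ?_
  refine Finset.sum_congr rfl fun i hi => ?_
  rw [Finset.mem_range] at hi
  have hN : (0 : ℝ) < N := by exact_mod_cast (Nat.zero_le i).trans_lt hi
  rw [(hξ N i hi).2]
  field_simp

/-- Young's inequality for the cross term of `a² - b² = 2a(a - b) - (a - b)²`. Only `a` and `a - b`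
appear on the right, so `κ` can be fixed before the approximant `b` is chosen. -/
theorem abs_sq_sub_sq_le (a b : ℝ) {κ : ℝ} (hκ : 0 < κ) :
    |a ^ 2 - b ^ 2| ≤ κ * a ^ 2 + (1 + 1 / κ) * (a - b) ^ 2 := by
  have h1 : 0 ≤ (κ * a - (a - b)) ^ 2 / κ := by positivity
  have h2 : 0 ≤ (κ * a + (a - b)) ^ 2 / κ := by positivity
  have e1 : (κ * a - (a - b)) ^ 2 / κ = κ * a ^ 2 - 2 * a * (a - b) + 1 / κ * (a - b) ^ 2 := by
    field_simp; ring
  have e2 : (κ * a + (a - b)) ^ 2 / κ = κ * a ^ 2 + 2 * a * (a - b) + 1 / κ * (a - b) ^ 2 := by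
    field_simp; ring
  rw [abs_le]
  constructor <;> nlinarith [sq_nonneg (a - b)]

theorem intervalIntegrable_of_memLp_two {f : ℝ → ℝ} {T : ℝ} (hT : 0 < T)
    (hf : MemLp f 2 (volume.restrict (Ioc 0 T))) :
    IntervalIntegrable f volume 0 T ∧ IntervalIntegrable (fun u => f u ^ 2) volume 0 T := by
  simp only [intervalIntegrable_iff_integrableOn_Ioc_of_le hT.le, IntegrableOn]
  exact ⟨hf.integrable (by norm_num), hf.integrable_sq⟩

theorem abs_cellEnergy_sub_le {f g : ℝ → ℝ} {T : ℝ} (hT : 0 < T) (N : ℕ)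
    (hf : IntervalIntegrable f volume 0 T) (hg : IntervalIntegrable g volume 0 T)
    {κ : ℝ} (hκ : 0 < κ) :
    |cellEnergy f T N - cellEnergy g T N| ≤
      κ * cellEnergy f T N + (1 + 1 / κ) * cellEnergy (fun u => f u - g u) T N := by
  simp only [cellEnergy, ← Finset.sum_sub_distrib, Finset.mul_sum, ← Finset.sum_add_distrib]
  refine (Finset.abs_sum_le_sum_abs _ _).trans (Finset.sum_le_sum fun i hi => ?_)
  rw [Finset.mem_range] at hi
  have hN : (0 : ℝ) < N := by exact_mod_cast (Nat.zero_le i).trans_lt hi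
  have hδ0 : 0 < T / N := by positivity
  rw [intervalIntegral.integral_sub (hf.mono_set (mem_uIcc_cell hT hi))
    (hg.mono_set (mem_uIcc_cell hT hi)), ← sub_div, abs_div, abs_of_pos hδ0]
  refine (div_le_div_of_nonneg_right (abs_sq_sub_sq_le _ _ hκ) hδ0.le).trans_eq ?_
  ring

/-- For `f ∈ L²([0, T])`, the mean squares of the cell averages converge to `∫ f²`. -/
theorem tendsto_cellEnergy {f : ℝ → ℝ} {T : ℝ} (hT : 0 < T)
    (hf : MemLp f 2 (volume.restrict (Ioc 0 T))) :
    Tendsto (cellEnergy f T) atTop (𝓝 (∫ u in (0 : ℝ)..T, f u ^ 2)) := by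
  obtain ⟨hf1, hf2⟩ := intervalIntegrable_of_memLp_two hT hf
  set S := ∫ u in (0 : ℝ)..T, f u ^ 2 with hS
  have hS0 : 0 ≤ S := intervalIntegral.integral_nonneg hT.le fun u _ => sq_nonneg _
  rw [Metric.tendsto_atTop]
  intro η hη
  -- `κ` depends on `f` alone, and the accuracy `ρ` of the approximation on `κ`. Replacing `f` by
  -- `g` then costs at most `η/4` in the energy and `η/4` in the integral; the continuous case takes
  -- the other `η/2`.
  set κ := η / (8 * (S + 1)) with hκ
  have hκ0 : 0 < κ := by positivity
  have hκS : κ * S ≤ η / 8 := by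
    rw [hκ, div_mul_eq_mul_div, div_le_div_iff₀ (by positivity) (by positivity)]; nlinarith
  set ρ := η / (8 * (1 + 1 / κ)) with hρ
  have hρ0 : 0 < ρ := by positivity
  have hρκ : (1 + 1 / κ) * ρ = η / 8 := by rw [hρ]; field_simp
  obtain ⟨g, hg, hgL⟩ := hf.exists_boundedContinuous_eLpNorm_sub_le (by norm_num)
    (ε := ENNReal.ofReal (√ρ)) (by simpa using Real.sqrt_pos.2 hρ0)
  obtain ⟨hd1, hd2⟩ := intervalIntegrable_of_memLp_two (f := fun u => f u - g u) hT (hf.sub hgL)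
  obtain ⟨hg1, hg2⟩ := intervalIntegrable_of_memLp_two hT hgL
  have hD : ∫ u in (0 : ℝ)..T, (f u - g u) ^ 2 ≤ ρ := by
    have h1 := (hf.sub hgL).eLpNorm_eq_integral_rpow_norm (by norm_num) (by norm_num)
    rw [h1, ENNReal.ofReal_le_ofReal_iff (Real.sqrt_nonneg _)] at hg
    have h2 : ∫ u in (0 : ℝ)..T, (f u - g u) ^ 2
        = ∫ a, ‖(f - ⇑g) a‖ ^ (ENNReal.toReal 2) ∂(volume.restrict (Ioc 0 T)) := by
      rw [intervalIntegral.integral_of_le hT.le]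
      congr 1; ext u; simp
    rw [← h2] at hg
    have h3 : 0 ≤ ∫ u in (0 : ℝ)..T, (f u - g u) ^ 2 :=
      intervalIntegral.integral_nonneg hT.le fun u _ => sq_nonneg _
    simp only [ENNReal.toReal_ofNat] at hg
    rw [show (2 : ℝ)⁻¹ = 1 / 2 by norm_num, ← Real.sqrt_eq_rpow] at hg
    exact (Real.sqrt_le_sqrt_iff hρ0.le).1 hg
  obtain ⟨M, hM⟩ := (Metric.tendsto_atTop.1
    (tendsto_cellEnergy_of_continuous g.continuous hT)) (η / 2) (by positivity)
  refine ⟨M + 1, fun N hN => ?_⟩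
  have hN0 : 0 < N := by omega
  have h1 := hM N (by omega)
  rw [Real.dist_eq] at h1 ⊢
  have h2 := abs_cellEnergy_sub_le hT N hf1 hg1 hκ0
  have h3 := cellEnergy_le hT hN0 hf1 hf2
  have h4 := (cellEnergy_le (f := fun u => f u - g u) hT hN0 hd1 hd2).trans hD
  have h5 : |S - ∫ u in (0 : ℝ)..T, g u ^ 2| ≤
      κ * S + (1 + 1 / κ) * ∫ u in (0 : ℝ)..T, (f u - g u) ^ 2 := by
    rw [hS, ← intervalIntegral.integral_sub hf2 hg2, ← intervalIntegral.integral_const_mul,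
      ← intervalIntegral.integral_const_mul,
      ← intervalIntegral.integral_add (hf2.const_mul _) (hd2.const_mul _)]
    refine (intervalIntegral.abs_integral_le_integral_abs hT.le).trans ?_
    exact intervalIntegral.integral_mono hT.le (hf2.sub hg2).abs
      ((hf2.const_mul _).add (hd2.const_mul _)) fun u => abs_sq_sub_sq_le _ _ hκ0
  have hκ1 : 0 < 1 + 1 / κ := by positivity
  have h6 := mul_le_mul_of_nonneg_left h3 hκ0.le
  have h7 := mul_le_mul_of_nonneg_left h4 hκ1.le
  have h8 := mul_le_mul_of_nonneg_left hD hκ1.le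
  rw [abs_lt] at h1 ⊢
  rw [abs_le] at h2 h5
  constructor <;> linarith [h2.1, h2.2, h5.1, h5.2]

/-- Variation of constants for the integrated linear equation `dy = -lam y dt + c db`, between the
times `-r` and `0`. -/
theorem linear_equation_solution {y b : ℝ → ℝ} (hy : Continuous y) (hb : Continuous b) {lam c : ℝ}
    (h : ∀ s t, y t - y s = -lam * (∫ u in s..t, y u) + c * (b t - b s)) (r : ℝ) :
    y 0 - c * b 0 = Real.exp (-(lam * r)) * (y (-r) - c * b (-r))
      - lam * c * ∫ u in (0 : ℝ)..r, Real.exp (-(lam * u)) * b (-u) := by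
  -- Subtracting the noise leaves a differentiable function, although `y` and `b` need not be.
  have hz : ∀ t, HasDerivAt (fun t => y t - c * b t) (-lam * y t) t := by
    intro t
    have he : (fun t => y t - c * b t)
        = fun t => (y 0 - c * b 0) + -lam * (∫ u in (0 : ℝ)..t, y u) := by
      ext t; linarith [h 0 t]
    rw [he]
    exact ((intervalIntegral.integral_hasDerivAt_right (hy.intervalIntegrable _ _)
      (hy.stronglyMeasurableAtFilter _ _) hy.continuousAt).const_mul _).const_add _
  have hF : ∀ t, HasDerivAt (fun r => Real.exp (-(lam * r)) * (y (-r) - c * b (-r)))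
      (lam * c * (Real.exp (-(lam * t)) * b (-t))) t := by
    intro t
    have h1 : HasDerivAt (fun r : ℝ => Real.exp (-(lam * r))) (Real.exp (-(lam * t)) * -(lam * 1)) t :=
      (((hasDerivAt_id t).const_mul lam).neg).exp
    have h2 := (hz (-t)).scomp t (hasDerivAt_neg t)
    refine (h1.mul h2).congr_deriv ?_
    simp only [smul_eq_mul, Function.comp_apply]; ring
  have := intervalIntegral.integral_eq_sub_of_hasDerivAt (a := 0) (b := r) (fun t _ => hF t)
    (Continuous.intervalIntegrable (by fun_prop) _ _)
  rw [intervalIntegral.integral_const_mul] at this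
  simp only [mul_zero, neg_zero, Real.exp_zero, one_mul] at this
  linarith

/-! ### The fBm covariance integrated against exponential weights -/

section Covariance

variable {lam κ : ℝ}

theorem integrable_exp_mul_rpow (hl : 0 < lam) (hκ : 0 < κ) :
    IntegrableOn (fun u : ℝ => Real.exp (-(lam * u)) * u ^ κ) (Ioi 0) := by
  refine (integrableOn_rpow_mul_exp_neg_mul_rpow (s := κ) (p := 1) (b := lam) (by linarith)
    one_pos hl).congr_fun (fun u _ => ?_) measurableSet_Ioi
  simp only [Real.rpow_one]; ring_nf

theorem integral_exp_mul_rpow (hl : 0 < lam) (hκ : 0 < κ) :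
    ∫ u in Ioi (0 : ℝ), Real.exp (-(lam * u)) * u ^ κ
      = Real.Gamma (κ + 1) / lam ^ (κ + 1) := by
  have := Real.integral_rpow_mul_exp_neg_mul_Ioi (a := κ + 1) (r := lam) (by linarith) hl
  simp only [add_sub_cancel_right] at this
  simp only [mul_comm (Real.exp _)]
  rw [this, Real.div_rpow zero_le_one hl.le, Real.one_rpow]
  ring

theorem integrable_exp_neg (hl : 0 < lam) :
    IntegrableOn (fun u : ℝ => Real.exp (-(lam * u))) (Ioi 0) := by
  simpa only [neg_mul] using integrableOn_exp_mul_Ioi (neg_neg_of_pos hl) 0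

theorem integral_exp_neg_mul (hl : 0 < lam) :
    ∫ u in Ioi (0 : ℝ), Real.exp (-(lam * u)) = 1 / lam := by
  have := integral_exp_mul_Ioi (neg_neg_of_pos hl) 0
  simp only [neg_mul, mul_zero, Real.exp_zero] at this
  rw [this]; field_simp

/-- The quadrant measure used in the covariance computations. -/
noncomputable abbrev quadrant : Measure (ℝ × ℝ) :=
  (volume.restrict (Ioi 0)).prod (volume.restrict (Ioi 0))

theorem ae_quadrant_pos : ∀ᵐ z ∂quadrant, 0 < z.1 ∧ 0 < z.2 := by
  rw [quadrant, Measure.prod_restrict]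
  filter_upwards [ae_restrict_mem (measurableSet_Ioi.prod measurableSet_Ioi)] with z hz
  exact hz

theorem integrable_quadrant_left (hl : 0 < lam) (hκ : 0 < κ) :
    Integrable (fun z : ℝ × ℝ =>
      Real.exp (-(lam * z.1)) * Real.exp (-(lam * z.2)) * z.1 ^ κ) quadrant := by
  refine ((integrable_exp_mul_rpow hl hκ).mul_prod (integrable_exp_neg hl)).congr
    (.of_forall fun z => ?_)
  simp only; ring

theorem integral_quadrant_left (hl : 0 < lam) (hκ : 0 < κ) :
    ∫ z, Real.exp (-(lam * z.1)) * Real.exp (-(lam * z.2)) * z.1 ^ κ ∂quadrant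
      = Real.Gamma (κ + 1) / lam ^ (κ + 1) / lam := by
  rw [div_eq_mul_one_div _ lam, ← integral_exp_mul_rpow hl hκ, ← integral_exp_neg_mul hl,
    ← integral_prod_mul]
  congr 1; ext z; ring

theorem integrable_quadrant_right (hl : 0 < lam) (hκ : 0 < κ) :
    Integrable (fun z : ℝ × ℝ =>
      Real.exp (-(lam * z.1)) * Real.exp (-(lam * z.2)) * z.2 ^ κ) quadrant := by
  refine (integrable_quadrant_left hl hκ).swap.congr (.of_forall fun z => ?_)
  simp only [Function.comp, Prod.fst_swap, Prod.snd_swap]; ring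

theorem integral_quadrant_right (hl : 0 < lam) (hκ : 0 < κ) :
    ∫ z, Real.exp (-(lam * z.1)) * Real.exp (-(lam * z.2)) * z.2 ^ κ ∂quadrant
      = Real.Gamma (κ + 1) / lam ^ (κ + 1) / lam := by
  rw [← integral_quadrant_left hl hκ, ← integral_prod_swap]
  congr 1; ext z
  simp only [Prod.fst_swap, Prod.snd_swap]; ring

theorem integrable_quadrant_posPart (hl : 0 < lam) (hκ : 0 < κ) :
    Integrable (fun z : ℝ × ℝ =>
      Real.exp (-(lam * z.1)) * Real.exp (-(lam * z.2)) * (max (z.1 - z.2) 0) ^ κ) quadrant := by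
  refine (integrable_quadrant_left hl hκ).mono' ?_ ?_
  · refine Continuous.aestronglyMeasurable ?_
    have := hκ.le
    fun_prop (disch := assumption)
  · filter_upwards [ae_quadrant_pos] with z hz
    rw [Real.norm_of_nonneg (by positivity)]
    gcongr
    exact max_le (by linarith [hz.2]) hz.1.le

/-- For fixed `v` the shift `u ↦ u + v` separates the variables and leaves the weight `e^{-2λv}`,
whence the `2 * lam`. -/
theorem integral_quadrant_posPart (hl : 0 < lam) (hκ : 0 < κ) :
    ∫ z, Real.exp (-(lam * z.1)) * Real.exp (-(lam * z.2)) * (max (z.1 - z.2) 0) ^ κ ∂quadrant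
      = Real.Gamma (κ + 1) / lam ^ (κ + 1) / (2 * lam) := by
  rw [integral_prod_symm _ (integrable_quadrant_posPart hl hκ)]
  have inner : ∀ v ∈ Ioi (0 : ℝ), ∫ u in Ioi (0 : ℝ),
      Real.exp (-(lam * u)) * Real.exp (-(lam * v)) * (max (u - v) 0) ^ κ
      = Real.exp (-(2 * lam * v)) * (Real.Gamma (κ + 1) / lam ^ (κ + 1)) := by
    intro v hv
    rw [← integral_exp_mul_rpow hl hκ, ← integral_const_mul, ← integral_indicator measurableSet_Ioi,
      ← integral_indicator measurableSet_Ioi]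
    refine Eq.trans ?_ (integral_sub_right_eq_self _ v)
    congr 1; ext u
    simp only [indicator, mem_Ioi] at hv ⊢
    by_cases huv : 0 < u - v
    · rw [if_pos (by linarith), if_pos huv, max_eq_left huv.le, ← mul_assoc, ← Real.exp_add,
        ← Real.exp_add]
      ring_nf
    · rw [if_neg huv, max_eq_right (not_lt.1 huv), Real.zero_rpow hκ.ne']
      simp
  rw [setIntegral_congr_fun measurableSet_Ioi inner, integral_mul_const,
    integral_exp_neg_mul (by positivity)]
  ring

theorem abs_sub_rpow_eq (hκ : 0 < κ) (u v : ℝ) :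
    |u - v| ^ κ = (max (u - v) 0) ^ κ + (max (v - u) 0) ^ κ := by
  rcases le_total v u with h | h
  · rw [abs_of_nonneg (by linarith), max_eq_left (by linarith), max_eq_right (by linarith),
      Real.zero_rpow hκ.ne', add_zero]
  · rw [abs_of_nonpos (by linarith), max_eq_right (by linarith), max_eq_left (by linarith),
      Real.zero_rpow hκ.ne', zero_add, neg_sub]

/-- In units of `Γ(κ+1) / λ^(κ+2)` the two pure powers contribute 1 each and the two halves of `|u -
v|^κ` contribute 1/2 each: `(1 + 1 - 1/2 - 1/2) / 2 = 1/2`. -/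
theorem integral_quadrant_covariance (hl : 0 < lam) (hκ : 0 < κ) :
    ∫ z, Real.exp (-(lam * z.1)) * Real.exp (-(lam * z.2)) *
      ((|z.1| ^ κ + |z.2| ^ κ - |z.1 - z.2| ^ κ) / 2) ∂quadrant
      = Real.Gamma (κ + 1) / lam ^ (κ + 1) / (2 * lam) := by
  have hsymm : Integrable (fun z : ℝ × ℝ =>
      Real.exp (-(lam * z.1)) * Real.exp (-(lam * z.2)) * (max (z.2 - z.1) 0) ^ κ) quadrant := by
    refine (integrable_quadrant_posPart hl hκ).swap.congr (.of_forall fun z => ?_)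
    simp only [Function.comp, Prod.fst_swap, Prod.snd_swap]; ring
  have hsymm' :
      ∫ z, Real.exp (-(lam * z.1)) * Real.exp (-(lam * z.2)) * (max (z.2 - z.1) 0) ^ κ ∂quadrant
      = Real.Gamma (κ + 1) / lam ^ (κ + 1) / (2 * lam) := by
    rw [← integral_quadrant_posPart hl hκ, ← integral_prod_swap]
    congr 1; ext z
    simp only [Prod.fst_swap, Prod.snd_swap]; ring
  have he : (fun z : ℝ × ℝ => Real.exp (-(lam * z.1)) * Real.exp (-(lam * z.2)) *
      ((|z.1| ^ κ + |z.2| ^ κ - |z.1 - z.2| ^ κ) / 2)) =ᵐ[quadrant] fun z =>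
      ((Real.exp (-(lam * z.1)) * Real.exp (-(lam * z.2)) * z.1 ^ κ
        + Real.exp (-(lam * z.1)) * Real.exp (-(lam * z.2)) * z.2 ^ κ)
        - (Real.exp (-(lam * z.1)) * Real.exp (-(lam * z.2)) * (max (z.1 - z.2) 0) ^ κ
        + Real.exp (-(lam * z.1)) * Real.exp (-(lam * z.2)) * (max (z.2 - z.1) 0) ^ κ)) / 2 := by
    filter_upwards [ae_quadrant_pos] with z hz
    rw [abs_sub_rpow_eq hκ, abs_of_pos hz.1, abs_of_pos hz.2]
    ring
  rw [integral_congr_ae he, integral_div, integral_sub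
    (by exact (integrable_quadrant_left hl hκ).add (integrable_quadrant_right hl hκ))
    (by exact (integrable_quadrant_posPart hl hκ).add hsymm),
    integral_add (integrable_quadrant_left hl hκ) (integrable_quadrant_right hl hκ),
    integral_add (integrable_quadrant_posPart hl hκ) hsymm, hsymm',
    integral_quadrant_left hl hκ, integral_quadrant_right hl hκ, integral_quadrant_posPart hl hκ]
  ring

end Covariance

/-! ### Continuous versions, Gaussian limits, convergence in probability -/

variable {Ω : Type*} [MeasurableSpace Ω] {P : Measure Ω}

/-- An almost surely continuous process has a measurable version with continuous paths, which is
indistinguishable from it. -/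
theorem exists_continuous_version {X : ℝ → Ω → ℝ} (hm : ∀ t, AEMeasurable (X t) P)
    (hc : ∀ᵐ ω ∂P, Continuous fun t => X t ω) :
    ∃ X' : ℝ → Ω → ℝ, (∀ t, Measurable (X' t)) ∧ (∀ ω, Continuous fun t => X' t ω) ∧
      ∀ᵐ ω ∂P, ∀ t, X t ω = X' t ω := by
  have hq : ∀ᵐ ω ∂P, ∀ q : ℚ, X q ω = (hm q).mk (X q) ω := ae_all_iff.2 fun q => (hm q).ae_eq_mk
  obtain ⟨S, hS, hSm, hSs⟩ := (hc.and hq).exists_measurable_mem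
  -- On the full-measure event `S` paths are continuous and agree with measurable variables at
  -- rational times; measurability at real times follows by limits.
  refine ⟨fun t => S.indicator (X t), fun t => ?_, fun ω => ?_, ?_⟩
  · obtain ⟨x, hx, hxt⟩ := mem_closure_iff_seq_limit.1 (Rat.denseRange_cast (𝕜 := ℝ) t)
    choose q hq using hx
    refine measurable_of_tendsto_metrizable
      (f := fun n => S.indicator ((hm (q n)).mk (X (q n))))
      (fun n => (hm (q n)).measurable_mk.indicator hSm) (tendsto_pi_nhds.2 fun ω => ?_)
    by_cases hω : ω ∈ S
    · simp only [indicator_of_mem hω]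
      refine (((hSs ω hω).1.tendsto t).comp hxt).congr fun n => ?_
      rw [← (hSs ω hω).2, hq, Function.comp_apply]
    · simp only [indicator_of_notMem hω]
      exact tendsto_const_nhds
  · by_cases hω : ω ∈ S
    · simpa only [indicator_of_mem hω] using (hSs ω hω).1
    · simpa only [indicator_of_notMem hω] using continuous_const
  · filter_upwards [hS] with ω hω t
    rw [indicator_of_mem hω]

/-- An almost sure limit of centred Gaussian variables is centred Gaussian. -/
theorem exists_hasLaw_gaussianReal_of_tendsto [IsProbabilityMeasure P] {X : ℕ → Ω → ℝ} {Z : Ω → ℝ}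
    (hX : ∀ n, ∃ v, HasLaw (X n) (gaussianReal 0 v) P)
    (h : ∀ᵐ ω ∂P, Tendsto (fun n => X n ω) atTop (𝓝 (Z ω))) :
    ∃ w, HasLaw Z (gaussianReal 0 w) P := by
  choose v hv using hX
  have hZ : AEMeasurable Z P := aemeasurable_of_tendsto_metrizable_ae atTop
    (fun n => (hv n).aemeasurable) h
  have : IsProbabilityMeasure (P.map Z) := Measure.isProbabilityMeasure_map hZ
  have hchar : ∀ (U : Ω → ℝ), AEMeasurable U P → ∀ t : ℝ,
      charFun (P.map U) t = ∫ ω, Complex.exp (t * U ω * Complex.I) ∂P := by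
    intro U hU t
    rw [charFun_apply_real, integral_map hU (by fun_prop)]
  have hlim : ∀ t : ℝ, Tendsto (fun n => Complex.exp (-((v n : ℝ) * t ^ 2 / 2 : ℝ))) atTop
      (𝓝 (charFun (P.map Z) t)) := by
    intro t
    have h1 : ∀ n, Complex.exp (-((v n : ℝ) * t ^ 2 / 2 : ℝ))
        = ∫ ω, Complex.exp (t * X n ω * Complex.I) ∂P := by
      intro n
      rw [← hchar _ (hv n).aemeasurable, (hv n).map_eq, charFun_gaussianReal]
      congr 1
      push_cast
      ring
    simp_rw [h1, hchar Z hZ]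
    refine tendsto_integral_of_dominated_convergence (fun _ => 1) (fun n => ?_) (by simp)
      (fun n => .of_forall fun ω => ?_) ?_
    · have := (hv n).aemeasurable
      exact AEMeasurable.aestronglyMeasurable (by fun_prop)
    · rw [← Complex.ofReal_mul, Complex.norm_exp_ofReal_mul_I]
    · filter_upwards [h] with ω hω
      refine Tendsto.cexp ((Tendsto.const_mul _ ?_).mul_const _)
      exact (Complex.continuous_ofReal.tendsto _).comp hω
  have hcont : Continuous (charFun (P.map Z)) := continuous_charFun
  -- Where the limiting characteristic function is nonzero, the logarithm of its modulus recovers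
  -- the limit of the variances.
  obtain ⟨t₀, ht₀, hφ⟩ : ∃ t₀ : ℝ, 0 < t₀ ∧ charFun (P.map Z) t₀ ≠ 0 := by
    have hne : ∀ᶠ t in 𝓝 (0 : ℝ), charFun (P.map Z) t ≠ 0 :=
      hcont.continuousAt.eventually_ne (by simp)
    have h2 := (hne.filter_mono nhdsWithin_le_nhds).and
      (self_mem_nhdsWithin : Ioi (0 : ℝ) ∈ 𝓝[>] 0)
    obtain ⟨t, ht⟩ := h2.exists
    exact ⟨t, ht.2, ht.1⟩
  have hlog : Tendsto (fun n => -((v n : ℝ) * t₀ ^ 2 / 2)) atTop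
      (𝓝 (Real.log ‖charFun (P.map Z) t₀‖)) := by
    refine ((hlim t₀).norm.log (norm_ne_zero_iff.2 hφ)).congr fun n => ?_
    rw [← Complex.ofReal_neg, Complex.norm_exp_ofReal, Real.log_exp]
  have hvlim : Tendsto (fun n => (v n : ℝ)) atTop
      (𝓝 (-2 / t₀ ^ 2 * Real.log ‖charFun (P.map Z) t₀‖)) := by
    refine (hlog.const_mul (-2 / t₀ ^ 2)).congr fun n => ?_
    field_simp
  set L := -2 / t₀ ^ 2 * Real.log ‖charFun (P.map Z) t₀‖ with hL
  have hL0 : 0 ≤ L := ge_of_tendsto' hvlim fun n => (v n).2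
  refine ⟨L.toNNReal, hZ, Measure.ext_of_charFun (funext fun t => ?_)⟩
  refine tendsto_nhds_unique (hlim t) ?_
  rw [charFun_gaussianReal, Real.coe_toNNReal _ hL0]
  have h3 : Tendsto (fun n => ((-((v n : ℝ) * t ^ 2 / 2) : ℝ) : ℂ)) atTop
      (𝓝 ((-(L * t ^ 2 / 2) : ℝ) : ℂ)) :=
    (Complex.continuous_ofReal.tendsto _).comp ((hvlim.mul_const _).div_const _).neg
  convert h3.cexp using 2
  · push_cast; rfl
  · congr 1
    simp

/-- Convergence in probability to a constant depends only on the individual laws, so each variable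
may be traded for one of the same law. -/
theorem tendstoInMeasure_zero_of_identDistrib [IsFiniteMeasure P] {X X' : ℕ → Ω → ℝ}
    (hd : ∀ n, IdentDistrib (X n) (X' n) P P)
    (h : ∀ᵐ ω ∂P, Tendsto (fun n => X' n ω) atTop (𝓝 0)) :
    TendstoInMeasure P X atTop fun _ => (0 : ℝ) := by
  have h1 := tendstoInMeasure_of_tendsto_ae
    (fun n => (hd n).aemeasurable_snd.aestronglyMeasurable) h
  rw [tendstoInMeasure_iff_norm] at h1 ⊢
  intro e he
  refine (h1 e he).congr fun n => ?_
  exact ((hd n).measure_mem_eq (s := {x | e ≤ ‖x - 0‖})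
    (measurableSet_le measurable_const (by fun_prop))).symm

/-! ### Moments of fBm and the integral of its past -/

namespace IsFractionalBrownianMotion

variable {H : ℝ} {B : ℝ → Ω → ℝ}

theorem congr {B' : ℝ → Ω → ℝ} (hB : IsFractionalBrownianMotion H B P)
    (h : ∀ᵐ ω ∂P, ∀ t, B t ω = B' t ω) : IsFractionalBrownianMotion H B' P where
  isGaussianProcess := hB.isGaussianProcess.congr fun t => by filter_upwards [h] with ω hω using hω t
  integral_eq_zero t := by
    rw [← hB.integral_eq_zero t]
    exact integral_congr_ae (by filter_upwards [h] with ω hω using (hω t).symm)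
  covariance_eq s t := by
    rw [← hB.covariance_eq s t]
    exact integral_congr_ae (by filter_upwards [h] with ω hω; rw [hω, hω])
  continuous_paths := by
    filter_upwards [h, hB.continuous_paths] with ω hω hc
    simpa only [hω] using hc

theorem integral_sq (hB : IsFractionalBrownianMotion H B P) (hH : 0 < H) (t : ℝ) :
    ∫ ω, B t ω ^ 2 ∂P = |t| ^ (2 * H) := by
  have := hB.covariance_eq t t
  rw [sub_self, abs_zero, Real.zero_rpow (by positivity)] at this
  simp only [sq]
  rw [this]; ring

theorem memLp_two (hB : IsFractionalBrownianMotion H B P) (t : ℝ) : MemLp (B t) 2 P :=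
  (hB.isGaussianProcess.hasGaussianLaw_eval t).memLp_two

theorem hasLaw (hB : IsFractionalBrownianMotion H B P) (hH : 0 < H) (t : ℝ) :
    HasLaw (B t) (gaussianReal 0 (|t| ^ (2 * H)).toNNReal) P where
  aemeasurable := hB.isGaussianProcess.aemeasurable t
  map_eq := by
    rw [(hB.isGaussianProcess.hasGaussianLaw_eval t).map_eq_gaussianReal,
      variance_of_integral_eq_zero (hB.isGaussianProcess.aemeasurable t) (hB.integral_eq_zero t),
      hB.integral_sq hH, hB.integral_eq_zero t]

theorem ae_zero_eq_zero (hB : IsFractionalBrownianMotion H B P) (hH : 0 < H) :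
    ∀ᵐ ω ∂P, B 0 ω = 0 := by
  have h := hB.integral_sq hH 0
  rw [abs_zero, Real.zero_rpow (by positivity),
    integral_eq_zero_iff_of_nonneg (fun ω => sq_nonneg _) (hB.memLp_two 0).integrable_sq] at h
  filter_upwards [h] with ω hω
  simpa using hω

theorem integral_abs_mul_le (hB : IsFractionalBrownianMotion H B P) (hH : 0 < H) (s t : ℝ) :
    ∫ ω, |B s ω * B t ω| ∂P ≤ (|s| ^ (2 * H) + |t| ^ (2 * H)) / 2 := by
  rw [← hB.integral_sq hH, ← hB.integral_sq hH,
    ← integral_add (hB.memLp_two s).integrable_sq (hB.memLp_two t).integrable_sq, ← integral_div]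
  refine integral_mono ((hB.memLp_two s).integrable_mul (hB.memLp_two t)).abs
    (((hB.memLp_two s).integrable_sq.add (hB.memLp_two t).integrable_sq).div_const 2) fun ω => ?_
  simp only
  rw [abs_le]
  constructor <;> nlinarith [sq_nonneg (B s ω - B t ω), sq_nonneg (B s ω + B t ω)]

theorem integral_abs_le (hB : IsFractionalBrownianMotion H B P) [IsProbabilityMeasure P]
    (hH : 0 < H) (t : ℝ) : ∫ ω, |B t ω| ∂P ≤ 1 + |t| ^ (2 * H) := by
  have h1 : ∫ _ω, (1 : ℝ) ∂P = 1 := by simp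
  rw [← hB.integral_sq hH, ← h1,
    ← integral_add (integrable_const _) (hB.memLp_two t).integrable_sq]
  refine integral_mono ((hB.memLp_two t).integrable (by norm_num)).abs
    ((integrable_const _).add (hB.memLp_two t).integrable_sq) fun ω => ?_
  simp only
  rw [abs_le]
  constructor <;> nlinarith [sq_nonneg (B t ω - 1), sq_nonneg (B t ω + 1)]

/-- Exponentially weighted integrals of the past of a fractional Brownian motion over bounded
intervals are centred Gaussian. -/
theorem exists_hasLaw_intervalIntegral (hB : IsFractionalBrownianMotion H B P)
    [IsProbabilityMeasure P] (hc : ∀ ω, Continuous fun t => B t ω) (lam : ℝ) {r : ℝ} (hr : 0 < r) :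
    ∃ w, HasLaw (fun ω => ∫ u in (0 : ℝ)..r, Real.exp (-(lam * u)) * B (-u) ω)
      (gaussianReal 0 w) P := by
  refine exists_hasLaw_gaussianReal_of_tendsto (X := fun N ω => ∑ i ∈ Finset.range N,
    r / N * (Real.exp (-(lam * (i * (r / N)))) * B (-(i * (r / N))) ω)) (fun N => ?_)
    (.of_forall fun ω => ?_)
  -- Each Riemann sum is a finite linear combination of a Gaussian process.
  · have hG := ((hB.isGaussianProcess.comp_right fun i : ℕ => -((i : ℝ) * (r / N))).smul
      (fun i : ℕ => r / N * Real.exp (-(lam * ((i : ℝ) * (r / N)))))).hasGaussianLaw_fun_sum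
      (I := Finset.range N)
    simp only [smul_eq_mul, Function.comp_apply, mul_assoc] at hG
    have hmap := hG.map_eq_gaussianReal
    rw [integral_finsetSum _ fun i _ => (((hB.memLp_two _).integrable (by norm_num)).const_mul
      _).const_mul _] at hmap
    simp only [integral_const_mul, hB.integral_eq_zero, mul_zero, Finset.sum_const_zero] at hmap
    exact ⟨_, hG.aemeasurable, hmap⟩
  · have hcω := hc ω
    refine tendsto_riemannSum (h := fun u => Real.exp (-(lam * u)) * B (-u) ω) (by fun_prop) hr
      (fun N i => i * (r / N)) fun N i hi => ⟨le_rfl, ?_⟩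
    have : 0 ≤ r / N := by positivity
    nlinarith

/-- The exponentially weighted integral of the whole past. -/
noncomputable def pastIntegral (lam : ℝ) (B : ℝ → Ω → ℝ) (ω : Ω) : ℝ :=
  ∫ u in Ioi (0 : ℝ), Real.exp (-(lam * u)) * B (-u) ω

variable {lam : ℝ}

/-- Tonelli: `E|B(-u)| ≤ 1 + u^(2H)` is integrable against the exponential weight. -/
theorem ae_integrableOn_past (hB : IsFractionalBrownianMotion H B P) [IsProbabilityMeasure P]
    (hH : 0 < H) (hm : Measurable (Function.uncurry B)) (hl : 0 < lam) :
    ∀ᵐ ω ∂P, IntegrableOn (fun u => Real.exp (-(lam * u)) * B (-u) ω) (Ioi 0) := by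
  have hmeas : Measurable fun z : ℝ × Ω => Real.exp (-(lam * z.1)) * B (-z.1) z.2 :=
    (by fun_prop : Measurable fun z : ℝ × Ω => Real.exp (-(lam * z.1))).mul
      (hm.comp (measurable_fst.neg.prodMk measurable_snd))
  have hI : Integrable (fun z : ℝ × Ω => Real.exp (-(lam * z.1)) * B (-z.1) z.2)
      ((volume.restrict (Ioi 0)).prod P) := by
    rw [integrable_prod_iff hmeas.aestronglyMeasurable]
    refine ⟨.of_forall fun u =>
      ((hB.memLp_two (-u)).integrable (by norm_num)).const_mul (Real.exp (-(lam * u))), ?_⟩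
    refine ((integrable_exp_neg hl).add
      (integrable_exp_mul_rpow hl (κ := 2 * H) (by positivity))).mono'
      hmeas.aestronglyMeasurable.norm.integral_prod_right' ?_
    filter_upwards [ae_restrict_mem measurableSet_Ioi] with u hu
    simp only [mem_Ioi] at hu
    rw [Real.norm_of_nonneg (integral_nonneg fun _ => norm_nonneg _)]
    simp only [norm_mul, Real.norm_eq_abs, Real.abs_exp, integral_const_mul, Pi.add_apply]
    rw [← mul_one_add]
    refine mul_le_mul_of_nonneg_left ?_ (Real.exp_pos _).le
    simpa [abs_of_pos hu] using hB.integral_abs_le hH (-u)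
  exact hI.prod_left_ae

/-- The square is a double integral over the quadrant; Fubini puts the covariance inside. -/
theorem integral_pastIntegral_sq (hB : IsFractionalBrownianMotion H B P) [IsProbabilityMeasure P]
    (hH : 0 < H) (hm : Measurable (Function.uncurry B)) (hl : 0 < lam) :
    ∫ ω, pastIntegral lam B ω ^ 2 ∂P
      = Real.Gamma (2 * H + 1) / lam ^ (2 * H + 1) / (2 * lam) := by
  set F : (ℝ × ℝ) → Ω → ℝ := fun z ω => (Real.exp (-(lam * z.1)) * B (-z.1) ω) *
    (Real.exp (-(lam * z.2)) * B (-z.2) ω) with hF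
  have hF' : ∀ z ω, F z ω = Real.exp (-(lam * z.1)) * Real.exp (-(lam * z.2)) *
      (B (-z.1) ω * B (-z.2) ω) := fun z ω => by rw [hF]; ring
  have hmeas : Measurable (Function.uncurry F) := by
    have h1 : Measurable fun z : (ℝ × ℝ) × Ω => B (-z.1.1) z.2 :=
      hm.comp ((measurable_fst.comp measurable_fst).neg.prodMk measurable_snd)
    have h2 : Measurable fun z : (ℝ × ℝ) × Ω => B (-z.1.2) z.2 :=
      hm.comp ((measurable_snd.comp measurable_fst).neg.prodMk measurable_snd)
    simp only [hF, Function.uncurry_def]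
    fun_prop
  have hint : ∀ s t, Integrable (fun ω => B s ω * B t ω) P := fun s t =>
    (hB.memLp_two s).integrable_mul (hB.memLp_two t)
  have hI : Integrable (Function.uncurry F) (quadrant.prod P) := by
    rw [integrable_prod_iff hmeas.aestronglyMeasurable]
    refine ⟨.of_forall fun z => ?_, ?_⟩
    · simp only [Function.uncurry_apply_pair, hF']
      exact (hint _ _).const_mul _
    · refine ((integrable_quadrant_left hl (κ := 2 * H) (by positivity)).add
        (integrable_quadrant_right hl (κ := 2 * H) (by positivity))).mono'
        hmeas.aestronglyMeasurable.norm.integral_prod_right' ?_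
      filter_upwards [ae_quadrant_pos] with z hz
      rw [Real.norm_of_nonneg (integral_nonneg fun _ => norm_nonneg _)]
      simp only [Function.uncurry_apply_pair, hF', norm_mul, Real.norm_eq_abs, Real.abs_exp,
        integral_const_mul, Pi.add_apply]
      rw [← mul_add]
      refine mul_le_mul_of_nonneg_left ?_ (by positivity)
      have h := hB.integral_abs_mul_le hH (-z.1) (-z.2)
      simp only [abs_neg, abs_of_pos hz.1, abs_of_pos hz.2, abs_mul] at h
      have h1 : 0 ≤ z.1 ^ (2 * H) := Real.rpow_nonneg hz.1.le _
      have h2 : 0 ≤ z.2 ^ (2 * H) := Real.rpow_nonneg hz.2.le _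
      linarith
  calc ∫ ω, pastIntegral lam B ω ^ 2 ∂P = ∫ ω, ∫ z, F z ω ∂quadrant ∂P := by
        congr 1; ext ω
        rw [sq, pastIntegral, ← integral_prod_mul]
    _ = ∫ z, ∫ ω, F z ω ∂P ∂quadrant := (integral_integral_swap hI).symm
    _ = _ := by
        rw [← integral_quadrant_covariance hl (κ := 2 * H) (by positivity)]
        congr 1; ext z
        simp only [hF', integral_const_mul, hB.covariance_eq]
        rw [show -z.2 - -z.1 = z.1 - z.2 by ring, abs_neg, abs_neg, add_comm (|z.2| ^ _)]

/-- Truncated integrals are centred Gaussian, hence so is their limit; the second moment then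
identifies the variance. -/
theorem hasLaw_pastIntegral (hB : IsFractionalBrownianMotion H B P) [IsProbabilityMeasure P]
    (hH : 0 < H) (hc : ∀ ω, Continuous fun t => B t ω) (hm : Measurable (Function.uncurry B))
    (hl : 0 < lam) :
    HasLaw (pastIntegral lam B)
      (gaussianReal 0 (Real.Gamma (2 * H + 1) / lam ^ (2 * H + 1) / (2 * lam)).toNNReal) P := by
  obtain ⟨w, hw⟩ := exists_hasLaw_gaussianReal_of_tendsto (Z := pastIntegral lam B)
    (fun n : ℕ => hB.exists_hasLaw_intervalIntegral hc lam (r := n + 1) (by positivity))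
    ((hB.ae_integrableOn_past hH hm hl).mono fun ω hω =>
      intervalIntegral_tendsto_integral_Ioi 0 hω
        (tendsto_atTop_add_const_right _ 1 tendsto_natCast_atTop_atTop))
  have hvar : Var[pastIntegral lam B; P] = w := by
    rw [hw.variance_eq, variance_id_gaussianReal]
  have hmean : ∫ ω, pastIntegral lam B ω ∂P = 0 := by
    rw [hw.integral_eq, integral_id_gaussianReal]
  rw [variance_of_integral_eq_zero hw.aemeasurable hmean, hB.integral_pastIntegral_sq hH hm hl]
    at hvar
  rw [hvar, Real.toNNReal_coe]
  exact hw

end IsFractionalBrownianMotion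

/-! ### The marginal law of the stationary solution -/

theorem IsStationary.aemeasurable {Y : ℝ → Ω → ℝ} (hY : IsStationary Y P) (t : ℝ) :
    AEMeasurable (Y t) P :=
  (measurable_pi_apply (⟨t, by simp⟩ : ({t} : Finset ℝ))).comp_aemeasurable
    (hY 0 {t}).aemeasurable_fst

theorem IsStationary.identDistrib {Y : ℝ → Ω → ℝ} (hY : IsStationary Y P) (s t : ℝ) :
    IdentDistrib (Y s) (Y t) P P := by
  have h := (hY (t - s) {s}).comp (measurable_pi_apply (⟨s, by simp⟩ : ({s} : Finset ℝ)))
  have h2 : (fun x : ({s} : Finset ℝ) → ℝ => x ⟨s, by simp⟩) ∘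
      (fun ω (i : ({s} : Finset ℝ)) => Y (i + (t - s)) ω) = Y t := by
    ext ω; simp
  rw [h2] at h
  exact h

section Stationary

variable {H ε : ℝ} {B Y : ℝ → Ω → ℝ}

/-- Stationarity replaces `Y (-(n + 1))` by the fixed variable `Y 0`, which the exponential factor
kills. -/
theorem tendstoInMeasure_exp_mul_stationary [IsProbabilityMeasure P] (hY : IsStationary Y P)
    {lam : ℝ} (hl : 0 < lam) :
    TendstoInMeasure P (fun (n : ℕ) ω => Real.exp (-(lam * (n + 1))) * Y (-(n + 1)) ω) atTop
      fun _ => (0 : ℝ) := by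
  refine tendstoInMeasure_zero_of_identDistrib
    (X' := fun n ω => Real.exp (-(lam * (n + 1))) * Y 0 ω)
    (fun n => (hY.identDistrib _ _).comp (measurable_const_mul _)) (.of_forall fun ω => ?_)
  have h : Tendsto (fun n : ℕ => lam * ((n : ℝ) + 1)) atTop atTop :=
    (tendsto_atTop_add_const_right _ 1 tendsto_natCast_atTop_atTop).const_mul_atTop hl
  simpa using (Real.tendsto_exp_neg_atTop_nhds_zero.comp h).mul_const (Y 0 ω)

/-- By self-similarity `B (-(n + 1))` has the law of `(n + 1)^H B (-1)`, and the exponential beats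
the power. -/
theorem tendstoInMeasure_exp_mul_fbm [IsProbabilityMeasure P]
    (hB : IsFractionalBrownianMotion H B P) (hH : 0 < H) {lam : ℝ} (hl : 0 < lam) :
    TendstoInMeasure P (fun (n : ℕ) ω => Real.exp (-(lam * (n + 1))) * B (-(n + 1)) ω) atTop
      fun _ => (0 : ℝ) := by
  refine tendstoInMeasure_zero_of_identDistrib
    (X' := fun n ω => Real.exp (-(lam * (n + 1))) * (((n : ℝ) + 1) ^ H * B (-1) ω))
    (fun n => IdentDistrib.comp (u := fun x : ℝ => Real.exp (-(lam * (n + 1))) * x)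
      ⟨hB.isGaussianProcess.aemeasurable _,
        (hB.isGaussianProcess.aemeasurable _).const_mul _, ?_⟩ (measurable_const_mul _))
    (.of_forall fun ω => ?_)
  · have hn : (0 : ℝ) < n + 1 := by positivity
    rw [(hB.hasLaw hH _).map_eq]
    have h1 := gaussianReal_const_mul (hB.hasLaw hH (-1)) (((n : ℝ) + 1) ^ H)
    rw [h1.map_eq]
    congr 1
    · simp
    · ext
      have habs : |(-((n : ℝ) + 1))| = n + 1 := by rw [abs_neg, abs_of_pos hn]
      rw [habs]
      simp [Real.rpow_nonneg hn.le, ← Real.rpow_natCast, ← Real.rpow_mul hn.le, mul_comm]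
  · have h : Tendsto (fun n : ℕ => ((n : ℝ) + 1)) atTop atTop :=
      tendsto_atTop_add_const_right _ 1 tendsto_natCast_atTop_atTop
    have h2 := ((tendsto_rpow_mul_exp_neg_mul_atTop_nhds_zero H lam hl).comp h).mul_const (B (-1) ω)
    rw [zero_mul] at h2
    refine h2.congr fun n => ?_
    simp only [Function.comp_apply, neg_mul]
    ring

/-- The stationary fractional Ornstein–Uhlenbeck process is standard normal at every time. -/
theorem IsStationaryFOU.hasLaw [IsProbabilityMeasure P] (hH : 0 < H) (hε : 0 < ε)
    (hB : IsFractionalBrownianMotion H B P) (hY : IsStationaryFOU H ε B Y P) (t : ℝ) :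
    HasLaw (Y t) (gaussianReal 0 1) P := by
  obtain ⟨b, hbm, hbc, hbB⟩ := exists_continuous_version
    (fun t => hB.isGaussianProcess.aemeasurable t) hB.continuous_paths
  have hb := hB.congr hbB
  have hbm' : Measurable (Function.uncurry b) := measurable_uncurry_of_continuous_of_measurable hbc hbm
  obtain ⟨lam, hlam⟩ : ∃ lam, lam = 1 / ε := ⟨_, rfl⟩
  have hl : 0 < lam := by rw [hlam]; positivity
  obtain ⟨c, hc⟩ : ∃ c, c = sigma H / ε ^ H := ⟨_, rfl⟩
  -- Two successive extractions make both boundary terms vanish almost surely along `ns ∘ ms`.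
  obtain ⟨ns, hns, hYns⟩ :=
    (tendstoInMeasure_exp_mul_stationary hY.isStationary hl).exists_seq_tendsto_ae
  obtain ⟨ms, hms, hbms⟩ :=
    ((tendstoInMeasure_exp_mul_fbm hb hH hl).comp hns.tendsto_atTop).exists_seq_tendsto_ae
  have hrep : ∀ᵐ ω ∂P, Y 0 ω = -(lam * c) * IsFractionalBrownianMotion.pastIntegral lam b ω := by
    filter_upwards [hYns, hbms, hbB, hY.continuous_paths, hY.equation, hb.ae_zero_eq_zero hH,
      hb.ae_integrableOn_past hH hbm' hl] with ω h1 h2 hBb hYc heq h0 hint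
    simp only [hBb, ← hlam, ← hc] at heq
    have hlim : Tendsto _ _ (𝓝 (IsFractionalBrownianMotion.pastIntegral lam b ω)) :=
      intervalIntegral_tendsto_integral_Ioi 0 hint
      (tendsto_atTop_add_const_right _ 1
        (tendsto_natCast_atTop_atTop.comp (hns.comp hms).tendsto_atTop))
    have h3 := ((h1.comp hms.tendsto_atTop).sub (h2.const_mul c)).sub (hlim.const_mul (lam * c))
    have h4 : ∀ n : ℕ, Y 0 ω = Real.exp (-(lam * (n + 1))) * Y (-(n + 1)) ω
        - c * (Real.exp (-(lam * (n + 1))) * b (-(n + 1)) ω)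
        - lam * c * ∫ u in (0 : ℝ)..(n + 1), Real.exp (-(lam * u)) * b (-u) ω := by
      intro n
      have := linear_equation_solution hYc (hbc ω) heq (n + 1)
      rw [h0] at this
      linarith
    refine tendsto_nhds_unique (f := fun k : ℕ => Y 0 ω) (l := atTop) tendsto_const_nhds
      (Tendsto.congr (fun k => (h4 (ns (ms k))).symm) ?_)
    convert h3 using 2
    · rfl
    · ring
  have hW := gaussianReal_const_mul (hb.hasLaw_pastIntegral hH hbc hbm' hl) (-(lam * c))
  have hY0 : HasLaw (Y 0) (gaussianReal 0 1) P := by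
    refine HasLaw.congr ?_ hrep
    convert hW using 2
    · simp
    · ext
      -- With `c² = (2 / Γ(2H+1)) λ^(2H)`, the variance `λ² c² Γ(2H+1) / (2 λ^(2H+2))` equals 1.
      have hG : 0 < Real.Gamma (2 * H + 1) := Real.Gamma_pos_of_pos (by positivity)
      have hσ : sigma H ^ 2 = 2 / Real.Gamma (2 * H + 1) := Real.sq_sqrt (by positivity)
      have hεH : (ε ^ H) ^ 2 = ε ^ (2 * H) := by
        rw [← Real.rpow_natCast, ← Real.rpow_mul hε.le]; push_cast; ring_nf
      have hpow : lam ^ (2 * H + 1) = (ε ^ (2 * H))⁻¹ * lam := by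
        rw [Real.rpow_add hl, Real.rpow_one, hlam, one_div, Real.inv_rpow hε.le]
      have he : 0 < ε ^ (2 * H) := by positivity
      have hnn : 0 ≤ Real.Gamma (2 * H + 1) / lam ^ (2 * H + 1) / (2 * lam) := by positivity
      simp only [NNReal.coe_one, NNReal.coe_mul, NNReal.coe_mk, Real.coe_toNNReal _ hnn]
      rw [neg_sq, mul_pow, hc, div_pow, hσ, hεH, hpow]
      generalize ε ^ (2 * H) = q at *
      field_simp
  exact ⟨hY.isStationary.aemeasurable t, by
    rw [← hY0.map_eq]; exact (hY.isStationary.identDistrib t 0).map_eq⟩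

end Stationary

/-! ### From the marginal law to almost every path -/

/-- A square-integrable functional of a measurable process with a constant marginal law has square
integrable paths. -/
theorem ae_memLp_comp_process [SFinite P] {μ : Measure ℝ} {y : ℝ → Ω → ℝ} {g : ℝ → ℝ}
    (hy : Measurable (Function.uncurry y)) (hlaw : ∀ t, HasLaw (y t) μ P) (hg : Measurable g)
    (hg2 : MemLp g 2 μ) (T : ℝ) :
    ∀ᵐ ω ∂P, MemLp (fun s => g (y s ω)) 2 (volume.restrict (Ioc 0 T)) := by
  have hmeas : Measurable fun z : Ω × ℝ => g (y z.2 z.1) := hg.comp (hy.comp measurable_swap)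
  have hfin : ∫⁻ ω, (∫⁻ s in Ioc 0 T, ‖g (y s ω)‖ₑ ^ (ENNReal.toReal 2)) ∂P ≠ ∞ := by
    rw [lintegral_lintegral_swap (hmeas.enorm.pow_const _).aemeasurable]
    have h1 : ∀ s, ∫⁻ ω, ‖g (y s ω)‖ₑ ^ (ENNReal.toReal 2) ∂P
        = ∫⁻ x, ‖g x‖ₑ ^ (ENNReal.toReal 2) ∂μ := by
      intro s
      rw [← (hlaw s).map_eq, lintegral_map' (hg.enorm.pow_const _).aemeasurable
        (hlaw s).aemeasurable]
    simp only [h1, lintegral_const, Measure.restrict_apply_univ, Real.volume_Ioc]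
    exact ENNReal.mul_ne_top ((eLpNorm_lt_top_iff_lintegral_rpow_enorm_lt_top (by norm_num)
      (by norm_num)).1 hg2.2).ne ENNReal.ofReal_ne_top
  filter_upwards [ae_lt_top (Measurable.lintegral_prod_right' (hmeas.enorm.pow_const _)) hfin]
    with ω hω
  refine ⟨(hmeas.comp measurable_prodMk_left).aestronglyMeasurable, ?_⟩
  exact (eLpNorm_lt_top_iff_lintegral_rpow_enorm_lt_top (by norm_num) (by norm_num)).2 hω

/-- Fubini on `P ⊗ ds`, applied to a measurable hull because `N` need not be measurable. -/
theorem ae_ae_notMem_of_null [SFinite P] {μ : Measure ℝ} {y : ℝ → Ω → ℝ}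
    (hy : Measurable (Function.uncurry y)) (hlaw : ∀ t, HasLaw (y t) μ P) {N : Set ℝ}
    (hN : μ N = 0) : ∀ᵐ ω ∂P, ∀ᵐ s : ℝ, y s ω ∉ N := by
  have h : ∀ᵐ s : ℝ, ∀ᵐ ω ∂P, y s ω ∉ toMeasurable μ N := .of_forall fun s => by
    have := (hlaw s).measure_eq (p := fun x => x ∈ toMeasurable μ N) (measurableSet_toMeasurable _ _)
    rw [ae_iff]
    simpa [hN] using this
  rw [Measure.ae_ae_comm (hy (measurableSet_toMeasurable μ N)).compl] at h
  filter_upwards [h] with ω hω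
  filter_upwards [hω] with s hs hmem
  exact hs (subset_toMeasurable _ _ hmem)

/-! ### The ratio estimator along a path -/

theorem quadVar_eq_cellEnergy {x f : ℝ → ℝ} {a T : ℝ} (hT : 0 < T)
    (hf : IntervalIntegrable f volume 0 T)
    (hx : ∀ t ∈ Icc 0 T, x t = x 0 + a * ∫ s in (0 : ℝ)..t, f s) (N : ℕ) :
    quadVar x N (T / N) = a ^ 2 * (T / N) * cellEnergy f T N := by
  rw [quadVar, cellEnergy, Finset.mul_sum]
  refine Finset.sum_congr rfl fun i hi => ?_
  rw [Finset.mem_range] at hi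
  have hN : (0 : ℝ) < N := by exact_mod_cast (Nat.zero_le i).trans_lt hi
  have hδ : 0 < T / N := by positivity
  have hsub := mem_uIcc_cell hT hi
  have m1 := hsub left_mem_uIcc
  have m2 := hsub right_mem_uIcc
  have i1 : IntervalIntegrable f volume 0 (i * (T / N)) :=
    hf.mono_set (uIcc_subset_uIcc left_mem_uIcc m1)
  have i2 : IntervalIntegrable f volume 0 ((i + 1) * (T / N)) :=
    hf.mono_set (uIcc_subset_uIcc left_mem_uIcc m2)
  rw [uIcc_of_le hT.le] at m1 m2
  rw [hx _ m1, hx _ m2, ← intervalIntegral.integral_interval_sub_left i2 i1]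
  field_simp
  ring

theorem hurstRatio_eq {x f : ℝ → ℝ} {a T : ℝ} (hT : 0 < T) (ha : a ≠ 0)
    (hf : IntervalIntegrable f volume 0 T)
    (hx : ∀ t ∈ Icc 0 T, x t = x 0 + a * ∫ s in (0 : ℝ)..t, f s) (N : ℕ) :
    hurstRatio x N (T / N) = 1 / 2 - 1 / (2 * Real.log 2) *
      Real.log (1 / 2 * (cellEnergy f T (2 * N) / cellEnergy f T N)) := by
  -- At `N = 0` both sums are empty and `log 0 = 0`, so both sides are `1/2`.
  rcases N.eq_zero_or_pos with rfl | hN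
  · simp [hurstRatio, quadVar, cellEnergy]
  have hN' : (0 : ℝ) < N := by exact_mod_cast hN
  have h2 : T / N / 2 = T / ((2 * N : ℕ) : ℝ) := by push_cast; field_simp
  rw [hurstRatio, h2, quadVar_eq_cellEnergy hT hf hx, quadVar_eq_cellEnergy hT hf hx,
    mul_div_mul_comm]
  congr 4
  push_cast
  field_simp

/-- The ratio estimator converges to `1` along any path whose velocity is square integrable and not
almost everywhere zero. -/
theorem tendsto_ratio_of_memLp {f : ℝ → ℝ} {T : ℝ} (hT : 0 < T)
    (hf : MemLp f 2 (volume.restrict (Ioc 0 T))) (h0 : 0 < ∫ s in (0 : ℝ)..T, f s ^ 2) :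
    Tendsto (fun N : ℕ => 1 / 2 - 1 / (2 * Real.log 2) *
      Real.log (1 / 2 * (cellEnergy f T (2 * N) / cellEnergy f T N))) atTop (𝓝 1) := by
  have h1 := tendsto_cellEnergy hT hf
  have h2 : Tendsto (fun N : ℕ => cellEnergy f T (2 * N)) atTop
      (𝓝 (∫ s in (0 : ℝ)..T, f s ^ 2)) :=
    h1.comp (tendsto_id.const_mul_atTop' two_pos)
  have h3 : Tendsto (fun N => 1 / 2 * (cellEnergy f T (2 * N) / cellEnergy f T N)) atTop _ :=
    (h2.div h1 h0.ne').const_mul (1 / 2)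
  rw [div_self h0.ne', mul_one] at h3
  have h4 := ((h3.log (by norm_num)).const_mul (1 / (2 * Real.log 2))).const_sub (1 / 2)
  have hlog : Real.log 2 ≠ 0 := (Real.log_pos (by norm_num)).ne'
  convert h4 using 2
  rw [one_div 2, Real.log_inv]
  field_simp
  norm_num

theorem measurable_cellEnergy {f : ℝ → Ω → ℝ} (hf : Measurable (Function.uncurry f)) (T : ℝ)
    (N : ℕ) : Measurable fun ω => cellEnergy (fun s => f s ω) T N := by
  have h : ∀ a b : ℝ, Measurable fun ω => ∫ u in a..b, f u ω := by
    intro a b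
    have hs : StronglyMeasurable (Function.uncurry fun ω u => f u ω) :=
      (hf.comp measurable_swap).stronglyMeasurable
    simp only [intervalIntegral]
    exact hs.integral_prod_right.measurable.sub hs.integral_prod_right.measurable
  simp only [cellEnergy]
  exact Finset.measurable_sum _ fun i _ => ((h _ _).pow_const 2).div_const _

theorem scaling_ne_zero {ε h : ℝ} (hε : 0 < ε) (hh : h = 1 / 2 → ε ≠ 1) : scaling ε h ≠ 0 := by
  rw [scaling]
  split_ifs with h1 h2
  · positivity
  · have := Real.log_ne_zero_of_pos_of_ne_one hε (hh h2)
    positivity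
  · positivity

/-- The ratio estimator is consistent for the value `1` as soon as the speed `a` of the slow
equation does not vanish. -/
theorem tendstoInMeasure_hurstRatio [IsProbabilityMeasure P] {H ε T a : ℝ} (hH : 0 < H)
    (hε : 0 < ε) (hT : 0 < T) (ha : a ≠ 0) {G : ℝ → ℝ} (hG : MemLp G 2 (gaussianReal 0 1))
    (hG0 : gaussianReal 0 1 {x | G x = 0} = 0) {B X Y : ℝ → Ω → ℝ}
    (hB : IsFractionalBrownianMotion H B P) (hY : IsStationaryFOU H ε B Y P)
    (hX : IsSlowSolution a G X Y P) :
    TendstoInMeasure P (fun (N : ℕ) (ω : Ω) => hurstRatio (fun t => X t ω) N (T / N)) atTop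
      fun _ => (1 : ℝ) := by
  have hlawY := hY.hasLaw hH hε hB
  obtain ⟨y, hym, hyc, hyY⟩ := exists_continuous_version
    (fun t => (hlawY t).aemeasurable) hY.continuous_paths
  have hy : Measurable (Function.uncurry y) := measurable_uncurry_of_continuous_of_measurable hyc hym
  have hlaw : ∀ t, HasLaw (y t) (gaussianReal 0 1) P := fun t =>
    (hlawY t).congr (by filter_upwards [hyY] with ω hω using (hω t).symm)
  -- A Borel version of `G`. It differs from `G` on a `γ`-null set, where almost every path of `Y`
  -- spends no time.
  set g := hG.1.mk G with hg
  have hgm : Measurable g := hG.1.stronglyMeasurable_mk.measurable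
  have hgG : G =ᵐ[gaussianReal 0 1] g := hG.1.ae_eq_mk
  have hg2 : MemLp g 2 (gaussianReal 0 1) := hG.ae_eq hgG
  have hgood : ∀ᵐ ω ∂P, MemLp (fun s => g (y s ω)) 2 (volume.restrict (Ioc 0 T)) ∧
      (0 < ∫ s in (0 : ℝ)..T, g (y s ω) ^ 2) ∧
      ∀ t ∈ Icc 0 T, X t ω = X 0 ω + a * ∫ s in (0 : ℝ)..t, g (y s ω) := by
    filter_upwards [ae_memLp_comp_process hy hlaw hgm hg2 T, ae_ae_notMem_of_null hy hlaw hG0,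
      ae_ae_notMem_of_null hy hlaw (ae_iff.1 hgG), hyY, hX] with ω h2 hne heq hYy hXω
    refine ⟨h2, ?_, fun t ht => ?_⟩
    · have hsq := (intervalIntegrable_of_memLp_two hT h2).2
      rw [intervalIntegral.integral_pos_iff_support_of_nonneg_ae
        (.of_forall fun s => sq_nonneg _) hsq]
      refine ⟨hT, ?_⟩
      have hae : Function.support (fun s => g (y s ω) ^ 2) =ᵐ[volume] univ := by
        rw [eventuallyEq_univ]
        filter_upwards [hne, heq] with s hs1 hs2
        simp only [not_not] at hs1 hs2
        rw [Function.mem_support, ← hs2]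
        exact pow_ne_zero 2 hs1
      rw [measure_congr (hae.inter (EventuallyEq.refl _ (Ioc 0 T))), univ_inter, Real.volume_Ioc]
      simpa using hT
    · rw [(hXω t ht.1).2]
      congr 2
      refine intervalIntegral.integral_congr_ae ?_
      filter_upwards [heq] with s hs _
      simp only [not_not] at hs
      rw [hYy, hs]
  -- `X` is not assumed measurable; the expression in cell energies is, and it equals the estimator
  -- almost surely.
  refine TendstoInMeasure.congr_left
    (f := fun (N : ℕ) ω => 1 / 2 - 1 / (2 * Real.log 2) * Real.log (1 / 2 *
      (cellEnergy (fun s => g (y s ω)) T (2 * N) / cellEnergy (fun s => g (y s ω)) T N)))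
    (fun N => ?_) (tendstoInMeasure_of_tendsto_ae (fun N => ?_) ?_)
  · filter_upwards [hgood] with ω hω
    exact (hurstRatio_eq (x := fun t => X t ω) hT ha
      (intervalIntegrable_of_memLp_two hT hω.1).1 hω.2.2 N).symm
  · have h := measurable_cellEnergy (f := fun s ω => g (y s ω)) (hgm.comp hy) T
    exact (((((h (2 * N)).div (h N)).const_mul _).log.const_mul _).const_sub _).aestronglyMeasurable
  · filter_upwards [hgood] with ω hω
    exact tendsto_ratio_of_memLp hT hω.1 hω.2.1

end SlowFast

theorem proposition3p2 {Ω : Type*} [MeasurableSpace Ω] (P : MeasureTheory.Measure Ω)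
    [MeasureTheory.IsProbabilityMeasure P]
    (H : ℝ) (hH0 : 0 < H) (hH1 : H < 1)
    (ε : ℝ) (hε : 0 < ε) (T : ℝ) (hT : 0 < T)
    (G : ℝ → ℝ) (p : ENNReal) (hp : 2 < p)
    (hG : MeasureTheory.MemLp G p (ProbabilityTheory.gaussianReal 0 1))
    (hG0 : ProbabilityTheory.gaussianReal 0 1 {x | G x = 0} = 0)
    (m : ℕ) (hm : SlowFast.IsHermiteRank G m)
    (hα : SlowFast.hStar H m = 1 / 2 → ε ≠ 1)
    (B X Y : ℝ → Ω → ℝ)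
    (hB : SlowFast.IsFractionalBrownianMotion H B P)
    (hY : SlowFast.IsStationaryFOU H ε B Y P)
    (hX : SlowFast.IsSlowSolution (SlowFast.scaling ε (SlowFast.hStar H m)) G X Y P) :
    MeasureTheory.TendstoInMeasure P
      (fun (N : ℕ) (ω : Ω) => SlowFast.hurstRatio (fun t => X t ω) N (T / N))
      Filter.atTop (fun _ => (1 : ℝ)) := by
  exact SlowFast.tendstoInMeasure_hurstRatio hH0 hε hT (SlowFast.scaling_ne_zero hε hα)
    (hG.mono_exponent hp.le) hG0 hB hY hX
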